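/- Fix an integer $D\ge 2$. For $k\ge 0$ let $\mathcal H_{D^k}=(\mathbb C^D)^{\otimes k}$, with orthonormal position basis $e_{\epsilon_1}\otimes\cdots\otimes e_{\epsilon_k}$, $\epsilon_i\in\{0,\dots,D-1\}$, ordered lexicographically (that is, as the $D$-nary expansions of $0,\dots,D^k-1$). Let $\mathcal F=\big(D^{-1/2}e^{-2\pi i ab/D}\big)_{0\le a,b<D}$, let $W_{D^k}$ be the Walsh transform on $\mathcal H_{D^k}$, determined by $$W_{D^k}(v^{(1)}\otimes\cdots\otimes v^{(k)})=\mathcal Fv^{(k)}\otimes\cdots\otimes\mathcal Fv^{(1)},$$ and, for $k\ge 1$, let $$B_k=W_{D^k}^{-1}\,\mathrm{diag}\big(W_{D^{k-1}},\dots,W_{D^{k-1}}\big)\qquad(D\text{ blocks})$$ in the position basis, be the Walsh-quantized $D$-baker's map. For $0\le\ell\le k$ and words $\epsilon\in\{0,\dots,D-1\}^{\ell}$, $\epsilon'\in\{0,\dots,D-1\}^{k-\ell}$, let $$|\epsilon'\cdot\epsilon\rangle=e_{\epsilon_1}\otimes\cdots\otimes e_{\epsilon_\ell}\otimes\mathcal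 F^*e_{\epsilon'_{k-\ell}}\otimes\cdots\otimes\mathcal F^*e_{\epsilon'_1},$$ and let $[\epsilon'\cdot\epsilon]\subset\mathbb T^2=(\mathbb R/\mathbb Z)^2\simeq[0,1)^2$ be the rectangle of the points $(q,p)$ such that the $D$-nary expansion of $q$ starts with $\epsilon_1\cdots\epsilon_\ell$ and that of $p$ with $\epsilon'_1\cdots\epsilon'_{k-\ell}$. The Husimi measure $WH^{k,\ell}_\psi$ of $\psi\in\mathcal H_{D^k}$ is the measure on $\mathbb T^2$ whose density with respect to Lebesgue measure equals $D^k|\langle\psi|\epsilon'\cdot\epsilon\rangle|^2$ on each rectangle $[\epsilon'\cdot\epsilon]$. Theorem (Quantum Ergodicity). For every $k\ge1$ let $(\psi_{k,j})_{j=0,\dots,D^k-1}$ be an orthonormal basis of $\mathcal H_{D^k}$ consisting of eigenvectors of $B_k$. Then for every $k\ge 1$ there is a nonempty subset $J_k\subset\{0,\dots,D^k-1\}$ such that - $\displaystyle\lim_{k\to\infty}\frac{\sharp J_k}{D^k}=1$; - for every sequence of integers $\ell(k)$ with $0\le\ell(k)\le k$, $\ell(k)\to\infty$ and $k-\ell(k)\to\infty$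 as $k\to\infty$, and every sequence $j(k)$ with $j(k)\in J_k$ for all $k\ge1$, the Husimi measures $WH^{k,\ell(k)}_{\psi_{k,j(k)}}$ converge weakly, as $k\to\infty$, to Lebesgue measure on $\mathbb T^2$. The sets $J_k$ do not depend on the sequences $\ell(k)$ and $j(k)$. -/

import Mathlib

open MeasureTheory Filter Topology

noncomputable section

namespace WalshBaker

/-- The quantum Hilbert space `(ℂ^D)^{⊗ k}` of dimension `D ^ k`, in the position basis. A position
index `0, …, D ^ k - 1` is identified with the word of its `D`-nary digits, the most significant
digit first (at index `0`). -/
abbrev QSpace (D k : ℕ) : Type := EuclideanSpace ℂ (Fin k → Fin D)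

/-- The `D`-dimensional discrete Fourier transform, with entries `D^{-1/2} exp(-2 π i a b / D)`. -/
def fourierMatrix (D : ℕ) : Matrix (Fin D) (Fin D) ℂ :=
  Matrix.of fun a b =>
    (1 / (Real.sqrt D : ℂ)) *
      Complex.exp (-2 * Complex.I * (Real.pi : ℂ) * ((b : ℕ) : ℂ) * ((a : ℕ) : ℂ) / (D : ℂ))

/-- The Walsh transform: `W (v₁ ⊗ ⋯ ⊗ v_k) = F v_k ⊗ ⋯ ⊗ F v₁`, as a matrix in the position
basis. -/
def walshMatrix (D k : ℕ) : Matrix (Fin k → Fin D) (Fin k → Fin D) ℂ :=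
  Matrix.of fun α β => ∏ i : Fin k, fourierMatrix D (α i) (β i.rev)

/-- The block diagonal matrix with `D` equal diagonal blocks, each being the Walsh transform on
`k` factors; the blocks are labelled by the first (most significant) digit. -/
def walshBlockMatrix (D k : ℕ) : Matrix (Fin (k + 1) → Fin D) (Fin (k + 1) → Fin D) ℂ :=
  Matrix.of fun α β =>
    if α 0 = β 0 then walshMatrix D k (Fin.tail α) (Fin.tail β) else 0

/-- The Walsh-quantized baker's map `B_k = W_{D^k}⁻¹ · diag(W_{D^{k-1}}, …, W_{D^{k-1}})`, for
`k ≥ 1`. The value at `k = 0` is a convention that is never used. -/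
def bakerMatrix (D : ℕ) : (k : ℕ) → Matrix (Fin k → Fin D) (Fin k → Fin D) ℂ
  | 0 => 1
  | k + 1 => (walshMatrix D (k + 1))⁻¹ * walshBlockMatrix D k

/-- The Walsh-quantized baker's map as an operator on the quantum Hilbert space. -/
def bakerOp (D k : ℕ) : Module.End ℂ (QSpace D k) :=
  Matrix.toEuclideanLin (bakerMatrix D k)

/-- The Walsh coherent state
`e_{ε₁} ⊗ ⋯ ⊗ e_{ε_ℓ} ⊗ F* e_{ε'_{k-ℓ}} ⊗ ⋯ ⊗ F* e_{ε'₁}` (for `ℓ ≤ k`) attached to the quantum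
rectangle `[ε'·ε]`. All digits are numbered from `0`. -/
def coherentState (D k l : ℕ) (ε : Fin l → Fin D) (ε' : Fin (k - l) → Fin D) : QSpace D k :=
  WithLp.toLp 2 fun α => ∏ i : Fin k,
    if h : (i : ℕ) < l then (if α i = ε ⟨i, h⟩ then 1 else 0)
    else (fourierMatrix D).conjTranspose (α i) (ε' ⟨k - 1 - i, by omega⟩)

/-- The 2-torus `(ℝ/ℤ)²`, with coordinates `x = (q, p)`. -/
abbrev Torus : Type := UnitAddCircle × UnitAddCircle

/-- The representative in `[0, 1)` of a point of `ℝ/ℤ`. -/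
def rep (t : UnitAddCircle) : ℝ := (AddCircle.equivIco (1 : ℝ) 0 t : ℝ)

/-- The first `n` digits of the `D`-nary expansion of a point of `ℝ/ℤ ≃ [0, 1)`. -/
def digitWord (D : ℕ) [NeZero D] (n : ℕ) (t : UnitAddCircle) : Fin n → Fin D :=
  fun i => Real.digits (rep t) D i

/-- The Walsh-Husimi function `WH^{k,ℓ}_ψ`. A point `x = (q, p)` lies in the quantum rectangle
`[ε'·ε]` whose `ε` is made of the first `ℓ` digits of `q` and `ε'` of the first `k - ℓ` digits
of `p`; there the function takes the value `D^k |⟨ψ, ε'·ε⟩|²`. -/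
def husimi (D : ℕ) [NeZero D] (k l : ℕ) (ψ : QSpace D k) (x : Torus) : ℝ :=
  (D : ℝ) ^ k *
    ‖inner ℂ ψ (coherentState D k l (digitWord D l x.1) (digitWord D (k - l) x.2))‖ ^ 2

theorem husimi_bounded (D : ℕ) [NeZero D] (k l : ℕ) (ψ : QSpace D k) :
    ∃ C : ℝ, ∀ x : Torus, husimi D k l ψ x ≤ C := by
  let g : (Fin l → Fin D) × (Fin (k - l) → Fin D) → ℝ := fun e =>
    (D : ℝ) ^ k * ‖inner ℂ ψ (coherentState D k l e.1 e.2)‖ ^ 2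
  obtain ⟨C, hC⟩ := (Set.finite_range g).bddAbove
  exact ⟨C, fun x => hC ⟨(digitWord D l x.1, digitWord D (k - l) x.2), rfl⟩⟩

theorem husimi_lintegral_ne_top (D : ℕ) [NeZero D] (k l : ℕ) (ψ : QSpace D k) :
    ∫⁻ x : Torus, ENNReal.ofReal (husimi D k l ψ x) ≠ ⊤ := by
  obtain ⟨C, hC⟩ := husimi_bounded D k l ψ
  have h : ∫⁻ x : Torus, ENNReal.ofReal (husimi D k l ψ x) ≤ ∫⁻ _ : Torus, ENNReal.ofReal C :=
    lintegral_mono fun x => ENNReal.ofReal_le_ofReal (hC x)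
  refine (h.trans_lt ?_).ne
  rw [lintegral_const]
  exact ENNReal.mul_lt_top ENNReal.ofReal_lt_top (measure_lt_top _ _)

/-- The Husimi measure: the measure on the torus with density `WH^{k,ℓ}_ψ` with respect to
Lebesgue measure. -/
def husimiMeasure (D : ℕ) [NeZero D] (k l : ℕ) (ψ : QSpace D k) : FiniteMeasure Torus :=
  ⟨(volume : Measure Torus).withDensity fun x => ENNReal.ofReal (husimi D k l ψ x),
    isFiniteMeasure_withDensity (husimi_lintegral_ne_top D k l ψ)⟩

/-- Lebesgue measure on the torus (of total mass one). -/
def lebesgueMeasure : FiniteMeasure Torus := ⟨volume, inferInstance⟩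

end WalshBaker

end

/-! The map acts on tensor products as a cyclic shift with one inverse Fourier transform: it sends
v₁ ⊗ ⋯ ⊗ v_k to v₂ ⊗ ⋯ ⊗ v_k ⊗ F*v₁ (`bakerMatrix_eq`). Hence it carries each coherent state of
level l + 1 exactly to one of level l with the word rotated, and the weights of an eigenvector at
level l are its weights at level 0 on rotated words (`weight_eq_weight_zero`).

The Husimi mass of a square of side D⁻ⁿ is the weight of a cylinder fixing the first and last n
letters, and it is the same at all levels n ≤ l ≤ k - n (`sum_weight_cylinder_eq`). So for an
eigenvector one number is also the level-0 weight of a whole family of rotated cylinders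
(`edgeMass_eq_sum_window`). About k/2n of these fix disjoint sets of letters, hence are independent
for uniform measure on words, and their averaged indicator has variance of order n/k. The level-0
weights of an eigenbasis form a doubly stochastic matrix, so Jensen turns this into a bound on the
mean squared deviation of the masses over the basis (`sum_sq_edgeMass_sub_le`).

Markov's inequality applied to a weighted sum over the countably many squares gives a single
sequence of sets of density one (`exists_density_one_subsets`). Convergence on all these squares
implies weak convergence (`tendsto_finiteMeasure_of_partitions`). -/

noncomputable section

namespace WalshBaker

/-! ### Tensor products of matrices and unitarity -/

section PiKronecker

variable {ι n : Type*} [Fintype ι]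

/-- The tensor product of a family of square matrices. -/
def piKronecker (A : ι → Matrix n n ℂ) : Matrix (ι → n) (ι → n) ℂ :=
  Matrix.of fun α β => ∏ i, A i (α i) (β i)

theorem sum_prod_eq_prod_sum [DecidableEq ι] [Fintype n] (f : ι → n → ℂ) :
    ∑ γ : ι → n, ∏ i, f i (γ i) = ∏ i, ∑ c, f i c := by
  rw [Finset.prod_univ_sum, Fintype.piFinset_univ]

theorem piKronecker_mul [DecidableEq ι] [Fintype n] (A B : ι → Matrix n n ℂ) :
    piKronecker A * piKronecker B = piKronecker fun i => A i * B i := by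
  ext α β
  simp only [piKronecker, Matrix.mul_apply, Matrix.of_apply, ← Finset.prod_mul_distrib]
  exact sum_prod_eq_prod_sum fun i c => A i (α i) c * B i c (β i)

theorem piKronecker_one [DecidableEq n] : piKronecker (fun _ : ι => (1 : Matrix n n ℂ)) = 1 := by
  ext α β
  simp only [piKronecker, Matrix.of_apply, Matrix.one_apply]
  split_ifs with h
  · simp [h]
  · obtain ⟨i, hi⟩ := Function.ne_iff.1 h
    exact Finset.prod_eq_zero (Finset.mem_univ i) (if_neg hi)

theorem piKronecker_conjTranspose (A : ι → Matrix n n ℂ) :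
    (piKronecker A).conjTranspose = piKronecker fun i => (A i).conjTranspose := by
  ext α β
  simp [piKronecker, Matrix.conjTranspose_apply]

variable [Fintype n] [DecidableEq n]

theorem piKronecker_mem_unitaryGroup [DecidableEq ι] {A : ι → Matrix n n ℂ}
    (hA : ∀ i, A i ∈ Matrix.unitaryGroup n ℂ) :
    piKronecker A ∈ Matrix.unitaryGroup (ι → n) ℂ := by
  rw [Matrix.mem_unitaryGroup_iff, Matrix.star_eq_conjTranspose, piKronecker_conjTranspose,
    piKronecker_mul, ← piKronecker_one]
  congr 1
  funext i
  exact Matrix.mem_unitaryGroup_iff.1 (hA i)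

theorem submatrix_mem_unitaryGroup {n : Type*} [Fintype n] [DecidableEq n] {M : Matrix n n ℂ}
    (hM : M ∈ Matrix.unitaryGroup n ℂ) (e : n ≃ n) : M.submatrix id e ∈ Matrix.unitaryGroup n ℂ := by
  rw [Matrix.mem_unitaryGroup_iff] at hM ⊢
  rw [Matrix.star_eq_conjTranspose] at hM ⊢
  rw [Matrix.conjTranspose_submatrix, Matrix.submatrix_mul_equiv, hM, Matrix.submatrix_id_id]

theorem sum_norm_sq_vecMul {n : Type*} [Fintype n] [DecidableEq n] {V : Matrix n n ℂ}
    (hV : V ∈ Matrix.unitaryGroup n ℂ) (b : n → ℂ) :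
    ∑ y, ‖(Matrix.vecMul b V) y‖ ^ 2 = ∑ y, ‖b y‖ ^ 2 := by
  have key : ∀ v : n → ℂ, ((∑ y, ‖v y‖ ^ 2 : ℝ) : ℂ) = v ⬝ᵥ star v := by
    intro v
    push_cast
    refine Finset.sum_congr rfl fun y _ => ?_
    rw [Pi.star_apply, Complex.star_def, Complex.mul_conj']
  have h : ((∑ y, ‖(Matrix.vecMul b V) y‖ ^ 2 : ℝ) : ℂ) = ((∑ y, ‖b y‖ ^ 2 : ℝ) : ℂ) := by
    rw [key, key, Matrix.star_vecMul, ← Matrix.dotProduct_mulVec, Matrix.mulVec_mulVec,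
      ← Matrix.star_eq_conjTranspose, Matrix.mem_unitaryGroup_iff.1 hV, Matrix.one_mulVec]
  exact_mod_cast h

theorem inner_toEuclideanLin_of_mem_unitaryGroup {n : Type*} [Fintype n] [DecidableEq n]
    {V : Matrix n n ℂ} (hV : V ∈ Matrix.unitaryGroup n ℂ) (x y : EuclideanSpace ℂ n) :
    inner ℂ (Matrix.toEuclideanLin V x) (Matrix.toEuclideanLin V y) = inner ℂ x y := by
  rw [← LinearMap.adjoint_inner_right, ← Matrix.toEuclideanLin_conjTranspose_eq_adjoint]
  congr 1
  ext i
  simp only [Matrix.toLpLin_apply, Matrix.mulVec_mulVec]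
  rw [← Matrix.star_eq_conjTranspose, Matrix.mem_unitaryGroup_iff'.1 hV, Matrix.one_mulVec]

end PiKronecker

/-! ### Unitarity of the discrete Fourier transform -/

section Fourier

variable (D : ℕ) [NeZero D]

theorem fourierMatrix_mem_unitaryGroup : fourierMatrix D ∈ Matrix.unitaryGroup (Fin D) ℂ := by
  have hD : (D : ℂ) ≠ 0 := Nat.cast_ne_zero.2 (NeZero.ne D)
  have hs : ((Real.sqrt D : ℝ) : ℂ) * ((Real.sqrt D : ℝ) : ℂ) = D := by
    rw [← Complex.ofReal_mul, Real.mul_self_sqrt (Nat.cast_nonneg D), Complex.ofReal_natCast]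
  have hs0 : ((Real.sqrt D : ℝ) : ℂ) ≠ 0 := by
    intro h
    rw [h, zero_mul] at hs
    exact hD hs.symm
  set ζ : ℂ := Complex.exp (2 * Real.pi * Complex.I / D) with hζ
  have hprim : IsPrimitiveRoot ζ D := Complex.isPrimitiveRoot_exp D (NeZero.ne D)
  have hζ0 : ζ ≠ 0 := Complex.exp_ne_zero _
  have hF : ∀ a b : Fin D, fourierMatrix D a b =
      1 / ((Real.sqrt D : ℝ) : ℂ) * (ζ ^ ((b : ℕ) * (a : ℕ)))⁻¹ := by
    intro a b
    rw [fourierMatrix, Matrix.of_apply, hζ, ← Complex.exp_nat_mul, ← Complex.exp_neg]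
    congr 2
    push_cast
    ring
  have hstar : star ζ = ζ⁻¹ := by
    rw [Complex.star_def, hζ, ← Complex.exp_conj, ← Complex.exp_neg]
    rw [← neg_div]
    congr 1
    simp [show (starRingEnd ℂ) 2 = 2 from map_ofNat _ 2]
  have hFs : ∀ a b : Fin D, star (fourierMatrix D a b) =
      1 / ((Real.sqrt D : ℝ) : ℂ) * ζ ^ ((b : ℕ) * (a : ℕ)) := by
    intro a b
    rw [hF, star_mul', star_inv₀, star_pow, hstar]
    simp
  rw [Matrix.mem_unitaryGroup_iff']
  ext a b
  rw [Matrix.mul_apply]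
  simp only [Matrix.star_apply, hFs]
  simp only [hF]
  have hterm : ∀ c : Fin D, 1 / ((Real.sqrt D : ℝ) : ℂ) * ζ ^ ((a : ℕ) * (c : ℕ)) *
      (1 / ((Real.sqrt D : ℝ) : ℂ) * (ζ ^ ((b : ℕ) * (c : ℕ)))⁻¹) =
      (1 / (D : ℂ)) * (ζ ^ (a : ℕ) / ζ ^ (b : ℕ)) ^ (c : ℕ) := by
    intro c
    rw [← hs, div_pow, ← pow_mul, ← pow_mul]
    field_simp
  rw [Finset.sum_congr rfl fun c _ => hterm c, ← Finset.mul_sum,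
    Fin.sum_univ_eq_sum_range fun c => (ζ ^ (a : ℕ) / ζ ^ (b : ℕ)) ^ c, Matrix.one_apply]
  split_ifs with hab
  · subst hab
    rw [div_self (pow_ne_zero _ hζ0)]
    simp [hD]
  · have hne : ζ ^ (a : ℕ) / ζ ^ (b : ℕ) ≠ 1 := by
      intro h
      rw [div_eq_one_iff_eq (pow_ne_zero _ hζ0)] at h
      exact hab (Fin.ext (hprim.pow_inj a.2 b.2 h))
    have hg := geom_sum_mul (ζ ^ (a : ℕ) / ζ ^ (b : ℕ)) D
    rw [div_pow, ← pow_mul, ← pow_mul, mul_comm (a : ℕ), mul_comm (b : ℕ), pow_mul, pow_mul,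
      hprim.pow_eq_one, one_pow, one_pow, div_one, sub_self] at hg
    rw [(mul_eq_zero.1 hg).resolve_right (sub_ne_zero.2 hne), mul_zero]

theorem fourierMatrix_mul_conjTranspose :
    fourierMatrix D * (fourierMatrix D).conjTranspose = 1 :=
  Matrix.mem_unitaryGroup_iff.1 (fourierMatrix_mem_unitaryGroup D)

theorem conjTranspose_fourierMatrix_mem_unitaryGroup :
    (fourierMatrix D).conjTranspose ∈ Matrix.unitaryGroup (Fin D) ℂ :=
  Unitary.star_mem (fourierMatrix_mem_unitaryGroup D)

end Fourier

/-! ### The baker's map as a shift, and its action on coherent states -/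

section Baker

variable (D : ℕ)

/-- Precomposition of words with a permutation of the positions. -/
def permWord (D : ℕ) {k : ℕ} (σ : Equiv.Perm (Fin k)) : (Fin k → Fin D) ≃ (Fin k → Fin D) where
  toFun y := y ∘ σ
  invFun y := y ∘ σ.symm
  left_inv y := by ext; simp
  right_inv y := by ext; simp

theorem walshMatrix_eq (k : ℕ) : walshMatrix D k =
    (piKronecker fun _ : Fin k => fourierMatrix D).submatrix id (permWord D Fin.revPerm) :=
  rfl

theorem walshMatrix_mem_unitaryGroup [NeZero D] (k : ℕ) :
    walshMatrix D k ∈ Matrix.unitaryGroup (Fin k → Fin D) ℂ :=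
  walshMatrix_eq D k ▸ submatrix_mem_unitaryGroup
    (piKronecker_mem_unitaryGroup fun _ => fourierMatrix_mem_unitaryGroup D) _

/-- The one-site factors of the baker's map: `F*` on the last site, the identity elsewhere. -/
def bakerFactor (D m : ℕ) (i : Fin (m + 1)) : Matrix (Fin D) (Fin D) ℂ :=
  if i = Fin.last m then (fourierMatrix D).conjTranspose else 1

/-- The reversals of m + 1 and of m sites compose to a rotation, and the Fourier factors cancel on
every site but one. Verifying diag(W, …, W) = W M avoids computing the inverse. -/
theorem bakerMatrix_eq [NeZero D] (m : ℕ) : bakerMatrix D (m + 1) =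
    (piKronecker (bakerFactor D m)).submatrix id (permWord D (finRotate (m + 1))) := by
  set M := (piKronecker (bakerFactor D m)).submatrix id (permWord D (finRotate (m + 1))) with hM
  have hW : (walshMatrix D (m + 1))⁻¹ * walshMatrix D (m + 1) = 1 := by
    refine Matrix.nonsing_inv_mul _ ?_
    exact (Matrix.isUnit_iff_isUnit_det _).1
      (Unitary.isUnit_coe (U := ⟨_, walshMatrix_mem_unitaryGroup D (m + 1)⟩))
  suffices h : walshBlockMatrix D m = walshMatrix D (m + 1) * M by
    rw [bakerMatrix, h, ← mul_assoc, hW, one_mul]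
  ext α β
  have h1 : (walshMatrix D (m + 1) * M) α β =
      ∏ i : Fin (m + 1), (fourierMatrix D * bakerFactor D m i.rev) (α i) (β (i.rev + 1)) := by
    -- Reversing the intermediate word aligns it with α, so that the sum over words factors site by
    -- site.
    rw [Matrix.mul_apply, ← (permWord D (Fin.revPerm (n := m + 1))).sum_comp]
    simp only [Matrix.mul_apply]
    rw [← sum_prod_eq_prod_sum]
    refine Finset.sum_congr rfl fun γ _ => ?_
    rw [Finset.prod_mul_distrib]
    congr 1
    · simp [walshMatrix, permWord]
    · rw [hM, Matrix.submatrix_apply, piKronecker, Matrix.of_apply, ← Equiv.prod_comp Fin.revPerm]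
      simp [permWord]
  rw [h1, Fin.prod_univ_succ]
  have h0 : bakerFactor D m (Fin.rev 0) = (fourierMatrix D).conjTranspose := by
    simp [bakerFactor]
  have hs : ∀ i : Fin m, bakerFactor D m (Fin.rev i.succ) = 1 := by
    intro i
    rw [Fin.rev_succ, bakerFactor, if_neg (Fin.castSucc_lt_last _).ne]
  rw [h0, fourierMatrix_mul_conjTranspose, walshBlockMatrix, Matrix.of_apply, Matrix.one_apply]
  simp only [hs, mul_one, Fin.rev_zero, Fin.last_add_one, ite_mul, one_mul, zero_mul]
  simp [walshMatrix, Fin.tail, Fin.rev_succ]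

theorem bakerFactor_mem_unitaryGroup [NeZero D] (m : ℕ) (i : Fin (m + 1)) :
    bakerFactor D m i ∈ Matrix.unitaryGroup (Fin D) ℂ := by
  unfold bakerFactor
  split_ifs
  exacts [conjTranspose_fourierMatrix_mem_unitaryGroup D, one_mem _]

theorem bakerMatrix_mem_unitaryGroup [NeZero D] (m : ℕ) :
    bakerMatrix D (m + 1) ∈ Matrix.unitaryGroup (Fin (m + 1) → Fin D) ℂ := by
  rw [bakerMatrix_eq]
  exact submatrix_mem_unitaryGroup
    (piKronecker_mem_unitaryGroup (bakerFactor_mem_unitaryGroup D m)) _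

/-- The one-site bases of the coherent states: position basis on the first `l` sites, momentum
basis on the other ones. -/
def siteBasis (D k l : ℕ) (i : Fin k) : Matrix (Fin D) (Fin D) ℂ :=
  if (i : ℕ) < l then 1 else (fourierMatrix D).conjTranspose

theorem siteBasis_mem_unitaryGroup [NeZero D] (k l : ℕ) (i : Fin k) :
    siteBasis D k l i ∈ Matrix.unitaryGroup (Fin D) ℂ := by
  unfold siteBasis
  split_ifs
  exacts [one_mem _, conjTranspose_fourierMatrix_mem_unitaryGroup D]

/-- The shift moves the position/momentum boundary one site to the left, and F* turns the position
vector leaving site 0 into the momentum vector required on the last site, which lies beyond the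
boundary because l ≤ m. -/
theorem bakerMatrix_mul_piKronecker_siteBasis [NeZero D] (m l : ℕ) (hl : l ≤ m) :
    bakerMatrix D (m + 1) * piKronecker (siteBasis D (m + 1) (l + 1)) =
      (piKronecker (siteBasis D (m + 1) l)).submatrix id (permWord D (finRotate (m + 1))) := by
  have h1 : piKronecker (siteBasis D (m + 1) (l + 1)) =
      (piKronecker fun i => siteBasis D (m + 1) (l + 1) (finRotate (m + 1) i)).submatrix
        (permWord D (finRotate (m + 1))) (permWord D (finRotate (m + 1))) := by
    ext α β
    simp only [piKronecker, Matrix.submatrix_apply, Matrix.of_apply, permWord, Equiv.coe_fn_mk,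
      Function.comp_apply]
    exact (Equiv.prod_comp (finRotate (m + 1))
      fun i => siteBasis D (m + 1) (l + 1) i (α i) (β i)).symm
  rw [h1, bakerMatrix_eq, Matrix.submatrix_mul_equiv, piKronecker_mul]
  congr 2
  funext i
  rcases eq_or_ne i (Fin.last m) with rfl | hi
  · simp [bakerFactor, siteBasis, hl]
  · simp only [bakerFactor, siteBasis, if_neg hi, one_mul, coe_finRotate_of_ne_last hi,
      Nat.add_lt_add_iff_right]

/-- The coherent state at level `l` whose sites are labelled by the word `y`. -/
def siteState (D k l : ℕ) (y : Fin k → Fin D) : QSpace D k :=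
  WithLp.toLp 2 fun α => piKronecker (siteBasis D k l) α y

theorem inner_siteState (k l : ℕ) (ψ : QSpace D k) (y : Fin k → Fin D) :
    inner ℂ ψ (siteState D k l y) =
      Matrix.vecMul (star ψ.ofLp) (piKronecker (siteBasis D k l)) y := by
  simp [siteState, EuclideanSpace.inner_eq_star_dotProduct, Matrix.vecMul, dotProduct_comm]

theorem bakerOp_siteState [NeZero D] (m l : ℕ) (hl : l ≤ m) (y : Fin (m + 1) → Fin D) :
    bakerOp D (m + 1) (siteState D (m + 1) (l + 1) y) =
      siteState D (m + 1) l (y ∘ finRotate (m + 1)) := by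
  ext α
  have := congrFun (congrFun (bakerMatrix_mul_piKronecker_siteBasis D m l hl) α) y
  rw [Matrix.mul_apply] at this
  simpa [bakerOp, Matrix.toLpLin_apply, siteState, Matrix.mulVec, dotProduct, permWord] using this

/-- The weight `|⟨ψ, y⟩|²` of `ψ` on the coherent state at level `l` labelled by `y`. -/
def weight (D k l : ℕ) (ψ : QSpace D k) (y : Fin k → Fin D) : ℝ :=
  ‖inner ℂ ψ (siteState D k l y)‖ ^ 2

theorem weight_nonneg (k l : ℕ) (ψ : QSpace D k) (y : Fin k → Fin D) :
    0 ≤ weight D k l ψ y := sq_nonneg _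

/-- An eigenvalue of an isometry has modulus one, so ψ can be replaced by Bψ up to a phase. -/
theorem norm_inner_eigenvector {E : Type*} [NormedAddCommGroup E] [InnerProductSpace ℂ E]
    {B : Module.End ℂ E} (hB : ∀ x y, inner ℂ (B x) (B y) = inner ℂ x y) {c : ℂ} {ψ : E}
    (h : Module.End.HasEigenvector B c ψ) (φ : E) : ‖inner ℂ ψ (B φ)‖ = ‖inner ℂ ψ φ‖ := by
  have hc : ‖c‖ ^ 2 = 1 := by
    have h1 := hB ψ ψ
    rw [h.apply_eq_smul, inner_smul_left, inner_smul_right, ← mul_assoc, Complex.conj_mul'] at h1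
    have h2 := mul_right_cancel₀ (inner_self_ne_zero.2 h.2) (h1.trans (one_mul _).symm)
    exact_mod_cast h2
  have hc1 : ‖c‖ = 1 := by
    rwa [pow_eq_one_iff_of_nonneg (norm_nonneg c) two_ne_zero] at hc
  rw [← hB ψ φ, h.apply_eq_smul, inner_smul_left, norm_mul, RCLike.norm_conj, hc1, one_mul]

theorem weight_eq_weight_zero [NeZero D] {k l : ℕ} (hl : l ≤ k) {c : ℂ} {ψ : QSpace D k}
    (h : Module.End.HasEigenvector (bakerOp D k) c ψ) (y : Fin k → Fin D) :
    weight D k l ψ y = weight D k 0 ψ (y ∘ (finRotate k)^[l]) := by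
  induction l generalizing y with
  | zero => rfl
  | succ l ih =>
    obtain ⟨m, rfl⟩ : ∃ m, k = m + 1 := ⟨k - 1, by omega⟩
    have h1 : weight D (m + 1) (l + 1) ψ y =
        weight D (m + 1) l ψ (y ∘ finRotate (m + 1)) := by
      rw [weight, weight, ← bakerOp_siteState D m l (by omega), norm_inner_eigenvector _ h]
      exact inner_toEuclideanLin_of_mem_unitaryGroup (bakerMatrix_mem_unitaryGroup D m)
    rw [h1, ih (by omega), Function.comp_assoc, ← Function.iterate_succ' (finRotate (m + 1)) l]

/-- The weight of a cylinder is the same at two levels that use the same basis on the fixed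
sites. -/
theorem sum_weight_cylinder_eq [NeZero D] (k : ℕ) {l l' : ℕ} (ψ : QSpace D k) (T : Finset (Fin k))
    (u : Fin k → Fin D) (hT : ∀ i ∈ T, ((i : ℕ) < l ↔ (i : ℕ) < l')) :
    ∑ y with ∀ i ∈ T, y i = u i, weight D k l ψ y =
      ∑ y with ∀ i ∈ T, y i = u i, weight D k l' ψ y := by
  classical
  -- U is the change of basis between the two levels. It is the identity on T, so it never mixes
  -- words that differ on T: it commutes with restriction to the cylinder, and unitarity preserves
  -- the restricted norm.
  set U : Fin k → Matrix (Fin D) (Fin D) ℂ :=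
    fun i => star (siteBasis D k l' i) * siteBasis D k l i with hU
  have hUT : ∀ i ∈ T, U i = 1 := by
    intro i hi
    have : siteBasis D k l i = siteBasis D k l' i := by simp [siteBasis, hT i hi]
    rw [hU]
    simp only [this]
    exact Matrix.mem_unitaryGroup_iff'.1 (siteBasis_mem_unitaryGroup D k l' i)
  have hUu : piKronecker U ∈ Matrix.unitaryGroup (Fin k → Fin D) ℂ :=
    piKronecker_mem_unitaryGroup fun i => mul_mem
      (Unitary.star_mem (siteBasis_mem_unitaryGroup D k l' i)) (siteBasis_mem_unitaryGroup D k l i)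
  have hmul : piKronecker (siteBasis D k l) =
      piKronecker (siteBasis D k l') * piKronecker U := by
    rw [piKronecker_mul]
    congr 1
    funext i
    rw [hU]
    simp only
    rw [← mul_assoc, Matrix.mem_unitaryGroup_iff.1 (siteBasis_mem_unitaryGroup D k l' i), one_mul]
  have hzero : ∀ y y' : Fin k → Fin D, (¬ ∀ i ∈ T, y' i = y i) → piKronecker U y' y = 0 := by
    intro y y' h
    push Not at h
    obtain ⟨i, hi, hne⟩ := h
    exact Finset.prod_eq_zero (Finset.mem_univ i) (by rw [hUT i hi, Matrix.one_apply_ne hne])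
  set a : (Fin k → Fin D) → ℂ := Matrix.vecMul (star ψ.ofLp) (piKronecker (siteBasis D k l))
    with ha
  set a' : (Fin k → Fin D) → ℂ := Matrix.vecMul (star ψ.ofLp) (piKronecker (siteBasis D k l'))
    with ha'
  have haa : a = Matrix.vecMul a' (piKronecker U) := by
    rw [ha, ha', hmul, Matrix.vecMul_vecMul]
  have hind : (fun y => if ∀ i ∈ T, y i = u i then a y else 0) =
      Matrix.vecMul (fun y => if ∀ i ∈ T, y i = u i then a' y else 0) (piKronecker U) := by
    funext y
    rw [haa]
    simp only [Matrix.vecMul, dotProduct]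
    split_ifs with hy
    · refine Finset.sum_congr rfl fun y' _ => ?_
      split_ifs with hy'
      · rfl
      · rw [hzero y y' fun h => hy' fun i hi => (h i hi).trans (hy i hi), mul_zero, mul_zero]
    · refine (Finset.sum_eq_zero fun y' _ => ?_).symm
      split_ifs with hy'
      · rw [hzero y y' fun h => hy fun i hi => (h i hi).symm.trans (hy' i hi), mul_zero]
      · rw [zero_mul]
  have hsum : ∀ b : (Fin k → Fin D) → ℂ,
      ∑ y with ∀ i ∈ T, y i = u i, ‖b y‖ ^ 2 =
        ∑ y, ‖(fun y => if ∀ i ∈ T, y i = u i then b y else 0) y‖ ^ 2 := by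
    intro b
    rw [Finset.sum_filter]
    refine Finset.sum_congr rfl fun y _ => ?_
    dsimp only
    split_ifs <;> simp
  simp only [weight, inner_siteState]
  rw [hsum, hsum, hind, sum_norm_sq_vecMul hUu]

theorem sum_weight [NeZero D] (k l : ℕ) (ψ : QSpace D k) : ∑ y, weight D k l ψ y = ‖ψ‖ ^ 2 := by
  simp only [weight, inner_siteState]
  rw [sum_norm_sq_vecMul (piKronecker_mem_unitaryGroup (siteBasis_mem_unitaryGroup D k l)),
    EuclideanSpace.norm_sq_eq]
  simp

theorem norm_siteState [NeZero D] (k l : ℕ) (y : Fin k → Fin D) : ‖siteState D k l y‖ = 1 := by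
  have h := congrFun (congrFun (Matrix.mem_unitaryGroup_iff'.1
    (piKronecker_mem_unitaryGroup (siteBasis_mem_unitaryGroup D k l))) y) y
  have h1 : ‖siteState D k l y‖ ^ 2 = 1 := by
    rw [EuclideanSpace.norm_sq_eq]
    rw [Matrix.mul_apply, Matrix.one_apply_eq] at h
    have h2 : ((∑ α, ‖siteState D k l y α‖ ^ 2 : ℝ) : ℂ) = 1 := by
      rw [← h]
      push_cast
      refine Finset.sum_congr rfl fun α _ => ?_
      rw [Matrix.star_apply, Complex.star_def, Complex.conj_mul']
      rfl
    exact_mod_cast h2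
  rwa [pow_eq_one_iff_of_nonneg (norm_nonneg _) two_ne_zero] at h1

/-- With `sum_weight`, this makes the matrix of weights doubly stochastic. -/
theorem sum_weight_orthonormalBasis [NeZero D] {ι : Type*} [Fintype ι] (k l : ℕ)
    (b : OrthonormalBasis ι ℂ (QSpace D k)) (y : Fin k → Fin D) :
    ∑ j, weight D k l (b j) y = 1 := by
  simp only [weight]
  rw [b.sum_sq_norm_inner_right, norm_siteState, one_pow]

end Baker

/-! ### Independence of cylinders under the uniform measure on words -/

section Counting

variable {k D : ℕ}

theorem card_cylinder (T : Finset (Fin k)) (u : Fin k → Fin D) :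
    ({x : Fin k → Fin D | ∀ i ∈ T, x i = u i} : Finset _).card * D ^ T.card = D ^ k := by
  have h : ({x : Fin k → Fin D | ∀ i ∈ T, x i = u i} : Finset _) =
      Fintype.piFinset fun i => if i ∈ T then {u i} else Finset.univ := by
    ext x
    simp only [Finset.mem_filter, Finset.mem_univ, true_and, Fintype.mem_piFinset]
    refine forall_congr' fun i => ?_
    split_ifs with hi <;> simp [hi]
  have h2 : D ^ T.card = ∏ i : Fin k, if i ∈ T then D else 1 := by
    rw [Finset.prod_ite_mem, Finset.univ_inter, Finset.prod_const]
  rw [h, Fintype.card_piFinset, h2, ← Finset.prod_mul_distrib]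
  calc _ = ∏ _i : Fin k, D := Finset.prod_congr rfl fun i _ => by split_ifs <;> simp
    _ = D ^ k := by simp

theorem card_cylinder_inter {T T' : Finset (Fin k)} (hT : Disjoint T T') (u u' : Fin k → Fin D) :
    ({x : Fin k → Fin D | (∀ i ∈ T, x i = u i) ∧ ∀ i ∈ T', x i = u' i} : Finset _).card *
      (D ^ T.card * D ^ T'.card) = D ^ k := by
  rw [← pow_add, ← Finset.card_union_of_disjoint hT,
    ← card_cylinder (T ∪ T') fun i => if i ∈ T then u i else u' i]
  congr 3
  ext x
  constructor
  · rintro ⟨h, h'⟩ i hi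
    split_ifs with hiT
    · exact h i hiT
    · exact h' i ((Finset.mem_union.1 hi).resolve_left hiT)
  · refine fun h => ⟨fun i hi => ?_, fun i hi => ?_⟩
    · simpa [hi] using h i (Finset.mem_union_left _ hi)
    · simpa [Finset.disjoint_right.1 hT hi] using h i (Finset.mem_union_right _ hi)

/-- The indicator of the words that agree with `u` on `T`. -/
def cylinderInd (T : Finset (Fin k)) (u x : Fin k → Fin D) : ℝ :=
  if ∀ i ∈ T, x i = u i then 1 else 0

theorem sum_cylinderInd [NeZero D] (T : Finset (Fin k)) (u : Fin k → Fin D) :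
    ∑ x, cylinderInd T u x = (D : ℝ) ^ k * ((D : ℝ) ^ T.card)⁻¹ := by
  have hD : (D : ℝ) ≠ 0 := Nat.cast_ne_zero.2 (NeZero.ne D)
  rw [eq_mul_inv_iff_mul_eq₀ (pow_ne_zero _ hD)]
  simp only [cylinderInd, Finset.sum_boole]
  exact_mod_cast card_cylinder T u

theorem sum_cylinderInd_mul [NeZero D] {T T' : Finset (Fin k)} (hT : Disjoint T T')
    (u u' : Fin k → Fin D) : ∑ x, cylinderInd T u x * cylinderInd T' u' x =
      (D : ℝ) ^ k * (((D : ℝ) ^ T.card)⁻¹ * ((D : ℝ) ^ T'.card)⁻¹) := by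
  have hD : (D : ℝ) ≠ 0 := Nat.cast_ne_zero.2 (NeZero.ne D)
  rw [← mul_inv, eq_mul_inv_iff_mul_eq₀ (mul_ne_zero (pow_ne_zero _ hD) (pow_ne_zero _ hD))]
  simp only [cylinderInd, ite_mul, one_mul, zero_mul, ← ite_and, Finset.sum_boole]
  exact_mod_cast card_cylinder_inter hT u u'

end Counting

/-! ### Variance of averages and Jensen's inequality -/

section Variance

/-- Orthogonality removes the off-diagonal terms of the expanded square, leaving at most MK to be
divided by M². -/
theorem sum_sq_average_le {X : Type*} [Fintype X] {M : ℕ} (g : Fin M → X → ℝ) {K : ℝ}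
    (h0 : ∀ s t, s ≠ t → ∑ x, g s x * g t x = 0) (h1 : ∀ t, ∑ x, g t x ^ 2 ≤ K) :
    ∑ x, ((∑ t, g t x) / M) ^ 2 ≤ K / M := by
  rcases Nat.eq_zero_or_pos M with rfl | hM
  · simp
  have hM' : (0 : ℝ) < M := Nat.cast_pos.2 hM
  have h : ∑ x, (∑ t, g t x) ^ 2 = ∑ t, ∑ x, g t x ^ 2 := by
    simp only [sq, Finset.sum_mul_sum]
    rw [Finset.sum_comm]
    refine Finset.sum_congr rfl fun s _ => ?_
    rw [Finset.sum_comm]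
    exact Finset.sum_eq_single s (fun t _ hts => h0 s t hts.symm) (by simp)
  simp only [div_pow]
  rw [← Finset.sum_div, h, div_le_div_iff₀ (by positivity) hM']
  calc (∑ t, ∑ x, g t x ^ 2) * M ≤ (∑ _t : Fin M, K) * M := by gcongr; exact h1 _
    _ = K * (M : ℝ) ^ 2 := by simp; ring

/-- Jensen along each row, then the column sums. -/
theorem sum_sq_average_stochastic_le {ι X : Type*} [Fintype ι] [Fintype X] {p : ι → X → ℝ}
    (hp : ∀ j x, 0 ≤ p j x) (h1 : ∀ j, ∑ x, p j x = 1) (h2 : ∀ x, ∑ j, p j x = 1) (h : X → ℝ) :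
    ∑ j, (∑ x, p j x * h x) ^ 2 ≤ ∑ x, h x ^ 2 := by
  calc ∑ j, (∑ x, p j x * h x) ^ 2 ≤ ∑ j, ∑ x, p j x * h x ^ 2 :=
        Finset.sum_le_sum fun j _ => Real.pow_arith_mean_le_arith_mean_pow_of_even _ _ _
          (fun x _ => hp j x) (h1 j) even_two
    _ = ∑ x, h x ^ 2 := by
        rw [Finset.sum_comm]
        exact Finset.sum_congr rfl fun x _ => by rw [← Finset.sum_mul, h2, one_mul]

end Variance

/-! ### Masses of edge cylinders and their quantum variance -/

section Mass

/-- The first `n` and the last `n` positions of a word of length `k`. -/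
def edges (k n : ℕ) : Finset (Fin k) := {i | (i : ℕ) < n ∨ k ≤ i + n}

theorem card_edges {k n : ℕ} (h : 2 * n ≤ k) : (edges k n).card = 2 * n := by
  have : (edges k n).map Fin.valEmbedding = Finset.range n ∪ Finset.Ico (k - n) k := by
    ext a
    simp only [edges, Finset.mem_map, Finset.mem_filter, Finset.mem_univ, true_and,
      Fin.valEmbedding_apply, Finset.mem_union, Finset.mem_range, Finset.mem_Ico]
    constructor
    · rintro ⟨i, hi, rfl⟩
      omega
    · intro ha
      exact ⟨⟨a, by omega⟩, by simp only; omega, rfl⟩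
  rw [← Finset.card_map Fin.valEmbedding, this, Finset.card_union_of_disjoint]
  · simp
    omega
  · rw [Finset.disjoint_left]
    simp
    omega

theorem val_iterate_finRotate {k : ℕ} (l : ℕ) (i : Fin k) :
    ((((finRotate k) ^ l : Equiv.Perm (Fin k)) i : Fin k) : ℕ) = (i + l) % k := by
  have := i.neZero
  induction l with
  | zero => simp [Nat.mod_eq_of_lt i.2]
  | succ l ih =>
    rw [pow_succ', Equiv.Perm.mul_apply, finRotate_apply, Fin.val_add, ih, Fin.val_one',
      ← Nat.add_mod, add_assoc]

/-- The positions that are sent to the edges by a rotation of `l` steps. -/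
def window (k n l : ℕ) : Finset (Fin k) :=
  {i | ((finRotate k) ^ l : Equiv.Perm (Fin k)) i ∈ edges k n}

theorem card_window {k n : ℕ} (l : ℕ) (h : 2 * n ≤ k) : (window k n l).card = 2 * n := by
  rw [← card_edges h]
  refine Finset.card_bijective _ ((finRotate k) ^ l : Equiv.Perm (Fin k)).bijective fun i => ?_
  simp [window]

/-- In this range of levels the two cyclic edges rotate back to one interval of length 2n centred at
k - l, without wrapping around. -/
theorem mem_window {k n l : ℕ} (h1 : n ≤ l) (h2 : l + n ≤ k) (i : Fin k) :
    i ∈ window k n l ↔ k ≤ i + l + n ∧ i + l < k + n := by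
  have hi := i.2
  simp only [window, edges, Finset.mem_filter, Finset.mem_univ, true_and, val_iterate_finRotate]
  rcases lt_or_ge ((i : ℕ) + l) k with h | h
  · rw [Nat.mod_eq_of_lt h]
    omega
  · rw [Nat.mod_eq_sub_mod h, Nat.mod_eq_of_lt (by omega)]
    omega

variable {D k : ℕ}

/-- The weight of the words that agree with `u` on the first and last `n` positions. -/
def edgeMass (n : ℕ) (u : Fin k → Fin D) (ψ : QSpace D k) : ℝ :=
  ∑ y with ∀ i ∈ edges k n, y i = u i, weight D k n ψ y

/-- All these levels use the position basis on the first n sites and the momentum basis on the last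
n. The reference level n in `edgeMass` is therefore immaterial, which is why the final sets need not
depend on l. -/
theorem sum_weight_edges [NeZero D] {n l : ℕ} (h1 : n ≤ l) (h2 : l + n ≤ k) (u : Fin k → Fin D)
    (ψ : QSpace D k) :
    ∑ y with ∀ i ∈ edges k n, y i = u i, weight D k l ψ y = edgeMass n u ψ := by
  refine sum_weight_cylinder_eq D k ψ _ u fun i hi => ?_
  simp only [edges, Finset.mem_filter, Finset.mem_univ, true_and] at hi
  omega

theorem edgeMass_nonneg (n : ℕ) (u : Fin k → Fin D) (ψ : QSpace D k) : 0 ≤ edgeMass n u ψ :=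
  Finset.sum_nonneg fun _ _ => weight_nonneg _ _ _ _ _

theorem edgeMass_le [NeZero D] (n : ℕ) (u : Fin k → Fin D) (ψ : QSpace D k) :
    edgeMass n u ψ ≤ ‖ψ‖ ^ 2 := by
  rw [← sum_weight D k n ψ]
  exact Finset.sum_le_sum_of_subset_of_nonneg (Finset.filter_subset _ _)
    fun _ _ _ => weight_nonneg _ _ _ _ _

/-- The left side does not involve l: the freedom in l is what permits averaging over levels. -/
theorem edgeMass_eq_sum_window [NeZero D] {n l : ℕ} (h1 : n ≤ l) (h2 : l + n ≤ k) (u : Fin k → Fin D)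
    {c : ℂ} {ψ : QSpace D k} (h : Module.End.HasEigenvector (bakerOp D k) c ψ) :
    edgeMass n u ψ = ∑ x, weight D k 0 ψ x *
      cylinderInd (window k n l) (u ∘ ((finRotate k) ^ l : Equiv.Perm (Fin k))) x := by
  rw [← sum_weight_edges h1 h2, Finset.sum_filter]
  refine Fintype.sum_equiv (permWord D ((finRotate k) ^ l : Equiv.Perm (Fin k))) _ _ fun y => ?_
  have hiff : (∀ i ∈ edges k n, y i = u i) ↔ ∀ i ∈ window k n l,
      permWord D ((finRotate k) ^ l : Equiv.Perm (Fin k)) y i =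
        (u ∘ ((finRotate k) ^ l : Equiv.Perm (Fin k))) i := by
    simp only [window, Finset.mem_filter, Finset.mem_univ, true_and, permWord, Equiv.coe_fn_mk,
      Function.comp_apply]
    exact ((finRotate k) ^ l : Equiv.Perm (Fin k)).forall_congr_right
      (q := fun i => i ∈ edges k n → y i = u i) |>.symm
  rw [weight_eq_weight_zero D (by omega) h, cylinderInd, if_congr hiff rfl rfl, mul_ite, mul_one,
    mul_zero, Equiv.Perm.iterate_eq_pow]
  rfl

theorem sum_sq_edgeMass_sub_le [NeZero D] {ι : Type*} [Fintype ι]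
    (b : OrthonormalBasis ι ℂ (QSpace D k))
    (hb : ∀ j, ∃ c : ℂ, Module.End.HasEigenvector (bakerOp D k) c (b j)) {n M : ℕ} (hM : 0 < M)
    (h : 2 * n * M ≤ k) (u : Fin k → Fin D) :
    ∑ j, (edgeMass n u (b j) - ((D : ℝ) ^ (2 * n))⁻¹) ^ 2 ≤ (D : ℝ) ^ k / M := by
  have hM' : (M : ℝ) ≠ 0 := Nat.cast_ne_zero.2 hM.ne'
  set a : ℝ := ((D : ℝ) ^ (2 * n))⁻¹ with ha
  have ha0 : 0 ≤ a := by positivity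
  have hnk : 2 * n ≤ k := le_trans (Nat.le_mul_of_pos_right _ hM) h
  -- Levels spaced by the window length 2n give disjoint windows; 2nM ≤ k keeps them all between n
  -- and k - n.
  let l : Fin M → ℕ := fun t => n + 2 * n * t
  have hl : ∀ t, n ≤ l t := fun t => Nat.le_add_right _ _
  have hl' : ∀ t, l t + n ≤ k := fun t => by
    have : 2 * n * (t + 1) ≤ 2 * n * M := Nat.mul_le_mul_left _ t.2
    simp only [l]
    linarith
  let g : Fin M → (Fin k → Fin D) → ℝ := fun t x =>
    cylinderInd (window k n (l t)) (u ∘ ((finRotate k) ^ (l t) : Equiv.Perm (Fin k))) x - a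
  have hsum : ∀ t, ∑ x, cylinderInd (window k n (l t))
      (u ∘ ((finRotate k) ^ (l t) : Equiv.Perm (Fin k))) x = (D : ℝ) ^ k * a := fun t => by
    rw [sum_cylinderInd, card_window _ hnk]
  have hconst : ∀ c : ℝ, ∑ _x : Fin k → Fin D, c = (D : ℝ) ^ k * c := fun c => by simp
  have hdisj : ∀ s t : Fin M, s < t → Disjoint (window k n (l s)) (window k n (l t)) := by
    intro s t hst
    rw [Finset.disjoint_left]
    intro i hs ht
    rw [mem_window (hl _) (hl' _)] at hs ht
    have : 2 * n * (s + 1) ≤ 2 * n * t := Nat.mul_le_mul_left _ hst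
    simp only [l] at hs ht
    rw [mul_add] at this
    omega
  have hg0 : ∀ s t, s ≠ t → ∑ x, g s x * g t x = 0 := by
    intro s t hst
    have hd : Disjoint (window k n (l s)) (window k n (l t)) :=
      (lt_or_gt_of_ne hst).elim (hdisj s t) fun h => (hdisj t s h).symm
    have := sum_cylinderInd_mul hd (u ∘ ((finRotate k) ^ (l s) : Equiv.Perm (Fin k)))
      (u ∘ ((finRotate k) ^ (l t) : Equiv.Perm (Fin k)))
    rw [card_window _ hnk, card_window _ hnk, ← ha] at this
    simp only [g, sub_mul, mul_sub, Finset.sum_sub_distrib, ← Finset.sum_mul, ← Finset.mul_sum,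
      this, hsum, hconst]
    ring
  have hg1 : ∀ t, ∑ x, g t x ^ 2 ≤ (D : ℝ) ^ k := by
    intro t
    have hsq : ∀ x, g t x ^ 2 = cylinderInd (window k n (l t))
        (u ∘ ((finRotate k) ^ (l t) : Equiv.Perm (Fin k))) x * (1 - 2 * a) + a ^ 2 := by
      intro x
      simp only [g, cylinderInd]
      split_ifs <;> ring
    rw [Finset.sum_congr rfl fun x _ => hsq x, Finset.sum_add_distrib, ← Finset.sum_mul, hsum,
      hconst]
    have hD : (0 : ℝ) ≤ (D : ℝ) ^ k := by positivity
    -- The exact value is Dᵏ(a - a²), and a - a² ≤ 1/4.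
    nlinarith [mul_nonneg hD (sq_nonneg (a - 1 / 2))]
  -- Every t yields the same deviation, so it equals its own average over t.
  have hdev : ∀ j, edgeMass n u (b j) - a =
      ∑ x, weight D k 0 (b j) x * ((∑ t, g t x) / M) := by
    intro j
    obtain ⟨c, hc⟩ := hb j
    have h1 : ∀ t, ∑ x, weight D k 0 (b j) x * g t x = edgeMass n u (b j) - a := by
      intro t
      simp only [g, mul_sub, Finset.sum_sub_distrib, ← Finset.sum_mul, sum_weight,
        b.orthonormal.1 j]
      rw [← edgeMass_eq_sum_window (hl t) (hl' t) u hc]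
      ring
    simp only [mul_div_assoc', Finset.mul_sum]
    rw [← Finset.sum_div, Finset.sum_comm, Finset.sum_congr rfl fun t _ => h1 t]
    simp
    field_simp
  rw [Finset.sum_congr rfl fun j _ => by rw [hdev j]]
  refine (sum_sq_average_stochastic_le (fun j x => weight_nonneg _ _ _ _ _) (fun j => ?_)
    (fun x => sum_weight_orthonormalBasis D k 0 b x) _).trans (sum_sq_average_le g hg0 hg1)
  rw [sum_weight, b.orthonormal.1 j, one_pow]

end Mass

/-! ### Extraction of subsets of density one -/

section DensityOne

/-- Markov's inequality for the uniform measure, with the threshold `√δ + δ` built from the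
average `δ`. -/
theorem exists_nonempty_le_sqrt_average {ι : Type*} [Fintype ι] [Nonempty ι] {f : ι → ℝ}
    (hf : ∀ j, 0 ≤ f j) {δ : ℝ} (hδ : (∑ j, f j) / Fintype.card ι = δ) :
    ∃ J : Finset ι, J.Nonempty ∧ 1 - √δ ≤ (J.card : ℝ) / Fintype.card ι ∧
      ∀ j ∈ J, f j ≤ √δ + δ := by
  classical
  have hN : (0 : ℝ) < Fintype.card ι := Nat.cast_pos.2 Fintype.card_pos
  have hsum : ∑ j, f j = δ * Fintype.card ι := (div_eq_iff hN.ne').1 hδ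
  have hδ0 : 0 ≤ δ := hδ ▸ div_nonneg (Finset.sum_nonneg fun j _ => hf j) hN.le
  have hs : 0 ≤ √δ := Real.sqrt_nonneg δ
  have hs2 : √δ * √δ = δ := Real.mul_self_sqrt hδ0
  -- The extra δ keeps the threshold at least the average, even when δ > 1, which ensures
  -- nonemptiness.
  refine ⟨({j | f j ≤ √δ + δ} : Finset ι), ?_, ?_, fun j hj => (Finset.mem_filter.1 hj).2⟩
  · obtain ⟨j, -, hj⟩ := Finset.exists_le_of_sum_le (s := Finset.univ) (f := f) (g := fun _ => δ)
      Finset.univ_nonempty (by simp [hsum, mul_comm])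
    exact ⟨j, by simp; linarith⟩
  · have hcard : (({j | f j ≤ √δ + δ} : Finset ι).card : ℝ) +
        (({j | ¬ f j ≤ √δ + δ} : Finset ι).card : ℝ) = Fintype.card ι := by
      exact_mod_cast Finset.card_filter_add_card_filter_not (s := Finset.univ)
        (fun j => f j ≤ √δ + δ)
    set bad : Finset ι := {j | ¬ f j ≤ √δ + δ} with hbad
    have hmarkov : (bad.card : ℝ) * (√δ + δ) ≤ δ * Fintype.card ι := by
      rw [← hsum, ← nsmul_eq_mul]
      refine (Finset.card_nsmul_le_sum bad f _ fun j hj => ?_).trans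
        (Finset.sum_le_sum_of_subset_of_nonneg (Finset.subset_univ _) fun j _ _ => hf j)
      exact (not_le.1 (Finset.mem_filter.1 hj).2).le
    have hb : (bad.card : ℝ) ≤ √δ * Fintype.card ι := by
      rcases hs.eq_or_lt with h0 | hpos
      · have hδ' : δ = 0 := (Real.sqrt_eq_zero hδ0).1 h0.symm
        have hz : ∀ j, f j = 0 := fun j =>
          (Finset.sum_eq_zero_iff_of_nonneg fun j _ => hf j).1
            (by rw [hsum, hδ', zero_mul]) j (Finset.mem_univ j)
        have : bad = ∅ := by
          rw [hbad, Finset.filter_eq_empty_iff]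
          intro j _
          rw [not_not, hz j]
          positivity
        rw [this, Finset.card_empty, Nat.cast_zero]
        positivity
      · refine le_of_mul_le_mul_right ?_ hpos
        have h3 : 0 ≤ (bad.card : ℝ) * δ := mul_nonneg (Nat.cast_nonneg _) hδ0
        calc (bad.card : ℝ) * √δ ≤ (bad.card : ℝ) * (√δ + δ) := by linarith
          _ ≤ √δ * √δ * Fintype.card ι := by rwa [hs2]
          _ = √δ * Fintype.card ι * √δ := by ring
    rw [le_div_iff₀ hN]
    linarith

/-- Countably many bounded quantities whose averages tend to zero all tend to zero along a common
sequence of subsets of density one. -/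
theorem exists_density_one_subsets {I : Type*} [Countable I] {N : ℕ → ℕ} [∀ k, NeZero (N k)]
    {d : I → ∀ k, Fin (N k) → ℝ} (h0 : ∀ i k j, 0 ≤ d i k j) (h1 : ∀ i k j, d i k j ≤ 1)
    (havg : ∀ i, Tendsto (fun k => (∑ j, d i k j) / N k) atTop (𝓝 0)) :
    ∃ J : ∀ k, Finset (Fin (N k)), (∀ k, (J k).Nonempty) ∧
      Tendsto (fun k => ((J k).card : ℝ) / N k) atTop (𝓝 1) ∧
      ∀ i, ∀ j : ∀ k, Fin (N k), (∀ᶠ k in atTop, j k ∈ J k) →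
        Tendsto (fun k => d i k (j k)) atTop (𝓝 0) := by
  have := Encodable.ofCountable I
  -- Summable positive weights merge all the quantities into one, E, so a single application of
  -- Markov's inequality serves every i.
  set a : I → ℝ := fun i => (1 / 2) ^ Encodable.encode i with ha
  have ha0 : ∀ i, 0 < a i := fun i => by positivity
  have hasum : Summable a := summable_geometric_two_encode
  have hle : ∀ i k j, a i * d i k j ≤ a i := fun i k j =>
    mul_le_of_le_one_right (ha0 i).le (h1 i k j)
  have hnn : ∀ i k j, 0 ≤ a i * d i k j := fun i k j => mul_nonneg (ha0 i).le (h0 i k j)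
  have hsummable : ∀ k j, Summable fun i => a i * d i k j := fun k j =>
    Summable.of_nonneg_of_le (fun i => hnn i k j) (fun i => hle i k j) hasum
  set E : ∀ k, Fin (N k) → ℝ := fun k j => ∑' i, a i * d i k j with hE
  have hE0 : ∀ k j, 0 ≤ E k j := fun k j => tsum_nonneg fun i => hnn i k j
  set δ : ℕ → ℝ := fun k => (∑ j, E k j) / N k with hδ
  have hNpos : ∀ k, (0 : ℝ) < N k := fun k => Nat.cast_pos.2 (NeZero.pos _)
  have hδeq : ∀ k, δ k = ∑' i, a i * ((∑ j, d i k j) / N k) := by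
    intro k
    rw [hδ]
    simp only [hE]
    rw [← Summable.tsum_finsetSum fun j _ => hsummable k j, ← tsum_div_const]
    refine tsum_congr fun i => ?_
    rw [← Finset.mul_sum, mul_div_assoc]
  have hδlim : Tendsto δ atTop (𝓝 0) := by
    rw [funext hδeq, ← tsum_zero (α := ℝ) (β := I)]
    -- Each averaged term tends to 0 and is dominated by a i.
    refine tendsto_tsum_of_dominated_convergence hasum (fun i => ?_)
      (Eventually.of_forall fun k i => ?_)
    · simpa using (havg i).const_mul (a i)
    · have hs : ∑ j, d i k j ≤ N k :=
        (Finset.sum_le_sum fun j _ => h1 i k j).trans (by simp)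
      rw [Real.norm_of_nonneg (mul_nonneg (ha0 i).le
        (div_nonneg (Finset.sum_nonneg fun j _ => h0 i k j) (hNpos k).le))]
      exact mul_le_of_le_one_right (ha0 i).le ((div_le_one (hNpos k)).2 hs)
  choose J hJne hJcard hJle using fun k =>
    exists_nonempty_le_sqrt_average (hE0 k) (δ := δ k) (by rw [Fintype.card_fin])
  simp only [Fintype.card_fin] at hJcard
  have hsqrt : Tendsto (fun k => √(δ k)) atTop (𝓝 0) := by
    simpa using hδlim.sqrt
  refine ⟨J, hJne, ?_, fun i j hj => ?_⟩
  · refine tendsto_of_tendsto_of_tendsto_of_le_of_le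
      (by simpa using hsqrt.const_sub 1) tendsto_const_nhds hJcard fun k => ?_
    refine (div_le_one (hNpos k)).2 ?_
    exact_mod_cast (Finset.card_le_univ (J k)).trans_eq (Fintype.card_fin _)
  · have hlim : Tendsto (fun k => (a i)⁻¹ * (√(δ k) + δ k)) atTop (𝓝 0) := by
      simpa using (hsqrt.add hδlim).const_mul (a i)⁻¹
    refine tendsto_of_tendsto_of_tendsto_of_le_of_le' tendsto_const_nhds hlim
      (Eventually.of_forall fun k => h0 i k (j k)) ?_
    filter_upwards [hj] with k hk
    rw [le_inv_mul_iff₀ (ha0 i)]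
    exact ((hsummable k (j k)).le_tsum i fun i' _ => hnn i' k (j k)).trans (hJle k _ hk)

end DensityOne

/-! ### Weak convergence from masses of partitions -/

section WeakConvergence

variable {X : Type*} [TopologicalSpace X] [MeasurableSpace X] [OpensMeasurableSpace X]

theorem abs_integral_sub_sum_le {E : Type*} [Fintype E] [MeasurableSpace E]
    [MeasurableSingletonClass E] (μ : Measure X) [IsFiniteMeasure μ] {P : X → E}
    (hP : Measurable P) (f : BoundedContinuousFunction X ℝ) (g : E → ℝ) {η : ℝ}
    (h : ∀ x, |f x - g (P x)| ≤ η) :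
    |∫ x, f x ∂μ - ∑ e, μ.real (P ⁻¹' {e}) * g e| ≤ η * μ.real Set.univ := by
  have hg : Integrable g (μ.map P) := Integrable.of_finite
  have hsum : ∑ e, μ.real (P ⁻¹' {e}) * g e = ∫ x, g (P x) ∂μ := by
    rw [← integral_map hP.aemeasurable hg.aestronglyMeasurable, integral_fintype hg]
    refine Finset.sum_congr rfl fun e _ => ?_
    rw [map_measureReal_apply hP (measurableSet_singleton e), smul_eq_mul]
  have hgP : Integrable (fun x => g (P x)) μ := hg.comp_measurable hP
  rw [hsum, ← integral_sub (f.integrable μ) hgP]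
  exact norm_integral_le_of_norm_le_const
    (Eventually.of_forall fun x => (Real.norm_eq_abs _).trans_le (h x))

/-- Weak convergence follows from the convergence of the masses of the pieces of finite partitions
on which bounded continuous functions have small oscillation. -/
theorem tendsto_finiteMeasure_of_partitions {E : ℕ → Type*} [∀ n, Fintype (E n)]
    [∀ n, MeasurableSpace (E n)] [∀ n, MeasurableSingletonClass (E n)] {P : ∀ n, X → E n}
    (hP : ∀ n, Measurable (P n))
    (hosc : ∀ f : BoundedContinuousFunction X ℝ, ∀ ε > 0, ∃ n, ∀ x y, P n x = P n y →
      |f x - f y| ≤ ε)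
    {μ : ℕ → FiniteMeasure X} {ν : FiniteMeasure X}
    (h : ∀ n e, Tendsto (fun k => (μ k : Measure X).real (P n ⁻¹' {e})) atTop
      (𝓝 ((ν : Measure X).real (P n ⁻¹' {e})))) :
    Tendsto μ atTop (𝓝 ν) := by
  classical
  have huniv : ∀ ρ : FiniteMeasure X,
      ∑ e, (ρ : Measure X).real (P 0 ⁻¹' {e}) = (ρ : Measure X).real Set.univ := by
    intro ρ
    rw [sum_measureReal_preimage_singleton Finset.univ
      fun e _ => hP 0 (measurableSet_singleton e)]
    simp
  have hmass : Tendsto (fun k => (μ k : Measure X).real Set.univ) atTop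
      (𝓝 ((ν : Measure X).real Set.univ)) := by
    simp only [← huniv]
    exact tendsto_finsetSum _ fun e _ => h 0 e
  rw [FiniteMeasure.tendsto_iff_forall_integral_tendsto]
  intro f
  rw [Metric.tendsto_nhds]
  intro ε hε
  set m : ℝ := (ν : Measure X).real Set.univ with hm
  have hm0 : 0 ≤ m := measureReal_nonneg
  -- The errors are at most η(m + 1) for μ k, ηm for ν and η for the finite sums, in total below
  -- η(2m + 3).
  set η : ℝ := ε / (2 * m + 3) with hη
  have hη0 : 0 < η := by positivity
  have hηε : η * (2 * m + 3) = ε := div_mul_cancel₀ _ (by positivity)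
  obtain ⟨n, hn⟩ := hosc f η hη0
  -- A sampled value of f on each piece; the default 0 occurs only on empty pieces.
  let g : E n → ℝ := fun e => if he : ∃ x, P n x = e then f he.choose else 0
  have hg : ∀ x, |f x - g (P n x)| ≤ η := by
    intro x
    have he : ∃ y, P n y = P n x := ⟨x, rfl⟩
    simp only [g, dif_pos he]
    exact hn _ _ he.choose_spec.symm
  have hsum : Tendsto (fun k => ∑ e, (μ k : Measure X).real (P n ⁻¹' {e}) * g e) atTop
      (𝓝 (∑ e, (ν : Measure X).real (P n ⁻¹' {e}) * g e)) :=
    tendsto_finsetSum _ fun e _ => (h n e).mul_const _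
  filter_upwards [hmass.eventually_lt_const (lt_add_one m),
    Metric.tendsto_nhds.1 hsum η hη0] with k hk1 hk2
  have e1 := abs_integral_sub_sum_le (μ k : Measure X) (hP n) f g hg
  have e2 := abs_integral_sub_sum_le (ν : Measure X) (hP n) f g hg
  have e3 : η * (μ k : Measure X).real Set.univ ≤ η * (m + 1) :=
    mul_le_mul_of_nonneg_left hk1.le hη0.le
  rw [Real.dist_eq] at hk2 ⊢
  rw [abs_le] at e1 e2
  rw [abs_lt] at hk2 ⊢
  constructor <;> nlinarith

end WeakConvergence

/-! ### Digits and D-adic intervals of the circle -/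

section Digits

theorem rep_mem (t : UnitAddCircle) : rep t ∈ Set.Ico (0 : ℝ) 1 := by
  have h := (AddCircle.equivIco (1 : ℝ) 0 t).2
  exact ⟨h.1, h.2.trans_eq (zero_add 1)⟩

theorem coe_rep (t : UnitAddCircle) : ((rep t : ℝ) : UnitAddCircle) = t :=
  AddCircle.coe_equivIco

theorem rep_coe {x : ℝ} (hx : x ∈ Set.Ico (0 : ℝ) 1) : rep (x : UnitAddCircle) = x := by
  rw [rep, AddCircle.equivIco_coe_eq (by rwa [zero_add])]

theorem measurable_rep : Measurable rep :=
  measurable_subtype_coe.comp (AddCircle.measurableEquivIco 1 0).measurable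

theorem volume_rep_preimage {A : Set ℝ} (hA : MeasurableSet A) :
    volume (rep ⁻¹' A) = volume (A ∩ Set.Ico 0 1) := by
  rw [AddCircle.add_projection_respects_measure 1 0 (measurable_rep hA), zero_add,
    ← measure_congr ((ae_eq_refl _).inter Ico_ae_eq_Ioc)]
  congr 1
  ext x
  simp only [Set.mem_inter_iff, Set.mem_preimage]
  refine and_congr_left fun hx => ?_
  rw [show (QuotientAddGroup.mk x : UnitAddCircle) = (x : UnitAddCircle) from rfl, rep_coe hx]

theorem dist_le_abs_rep_sub (s t : UnitAddCircle) : dist s t ≤ |rep s - rep t| := by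
  rw [dist_eq_norm, ← Real.norm_eq_abs]
  conv_lhs => rw [← coe_rep s, ← coe_rep t, ← AddCircle.coe_sub]
  exact QuotientAddGroup.norm_mk_le_norm

variable {D : ℕ} [NeZero D]

/-- The leading n digits are the base-D digits of the integer ⌊Dⁿ t⌋, by nested floors. `Fin.rev`
appears because `finFunctionFinEquiv` puts the least significant digit first. -/
theorem digitWord_eq_iff (n : ℕ) (t : UnitAddCircle) (w : Fin n → Fin D) :
    digitWord D n t = w ↔
      ⌊rep t * (D : ℝ) ^ n⌋₊ = (finFunctionFinEquiv (w ∘ Fin.rev) : ℕ) := by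
  have hD : 0 < D := NeZero.pos D
  have hDn : (0 : ℝ) < (D : ℝ) ^ n := by positivity
  have hlt : ⌊rep t * (D : ℝ) ^ n⌋₊ < D ^ n := by
    rw [Nat.floor_lt (mul_nonneg (rep_mem t).1 hDn.le)]
    push_cast
    exact mul_lt_of_lt_one_left hDn (rep_mem t).2
  have hdig : digitWord D n t =
      finFunctionFinEquiv.symm ⟨⌊rep t * (D : ℝ) ^ n⌋₊, hlt⟩ ∘ Fin.rev := by
    funext i
    apply Fin.ext
    have hpow : (D : ℝ) ^ n = (D : ℝ) ^ ((i : ℕ) + 1) * ((D ^ (n - (i + 1)) : ℕ) : ℝ) := by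
      push_cast
      rw [← pow_add]
      congr 1
      omega
    have : rep t * (D : ℝ) ^ ((i : ℕ) + 1) =
        rep t * (D : ℝ) ^ n / ((D ^ (n - (i + 1)) : ℕ) : ℝ) := by
      rw [hpow, ← mul_assoc, mul_div_cancel_right₀]
      positivity
    simp only [digitWord, Real.digits, Fin.val_ofNat, Function.comp_apply,
      finFunctionFinEquiv_symm_apply_val, Fin.val_rev]
    rw [this, Nat.floor_div_natCast]
  rw [hdig]
  constructor
  · rintro rfl
    have : (finFunctionFinEquiv.symm ⟨⌊rep t * (D : ℝ) ^ n⌋₊, hlt⟩ ∘ Fin.rev) ∘ Fin.rev =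
        finFunctionFinEquiv.symm ⟨⌊rep t * (D : ℝ) ^ n⌋₊, hlt⟩ := by
      funext i
      simp
    rw [this, Equiv.apply_symm_apply]
  · intro h
    have : (⟨⌊rep t * (D : ℝ) ^ n⌋₊, hlt⟩ : Fin (D ^ n)) = finFunctionFinEquiv (w ∘ Fin.rev) :=
      Fin.ext h
    rw [this, Equiv.symm_apply_apply]
    funext i
    simp

theorem digitWord_preimage (n : ℕ) (w : Fin n → Fin D) :
    digitWord D n ⁻¹' {w} = rep ⁻¹' Set.Ico
      (((finFunctionFinEquiv (w ∘ Fin.rev) : ℕ) : ℝ) / (D : ℝ) ^ n)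
      ((((finFunctionFinEquiv (w ∘ Fin.rev) : ℕ) : ℝ) + 1) / (D : ℝ) ^ n) := by
  have hDn : (0 : ℝ) < (D : ℝ) ^ n := pow_pos (Nat.cast_pos.2 (NeZero.pos D)) n
  ext t
  simp only [Set.mem_preimage, Set.mem_singleton_iff, digitWord_eq_iff, Set.mem_Ico,
    div_le_iff₀ hDn, lt_div_iff₀ hDn]
  exact Nat.floor_eq_iff (mul_nonneg (rep_mem t).1 hDn.le)

theorem measurable_digitWord (n : ℕ) : Measurable (digitWord D n) :=
  measurable_to_countable' fun w => by
    rw [digitWord_preimage]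
    exact measurable_rep measurableSet_Ico

theorem volume_digitWord_preimage (n : ℕ) (w : Fin n → Fin D) :
    volume (digitWord D n ⁻¹' {w}) = ENNReal.ofReal (((D : ℝ) ^ n)⁻¹) := by
  have hDn : (0 : ℝ) < (D : ℝ) ^ n := pow_pos (Nat.cast_pos.2 (NeZero.pos D)) n
  set m := finFunctionFinEquiv (w ∘ Fin.rev) with hm
  have hlt : ((m : ℕ) : ℝ) + 1 ≤ (D : ℝ) ^ n := by exact_mod_cast m.2
  rw [digitWord_preimage, volume_rep_preimage measurableSet_Ico, Set.inter_eq_left.2,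
    Real.volume_Ico]
  · congr 1
    rw [← sub_div, add_sub_cancel_left, one_div]
  · exact Set.Ico_subset_Ico (by positivity) ((div_le_one hDn).2 hlt)

theorem dist_le_of_digitWord_eq {n : ℕ} {s t : UnitAddCircle}
    (h : digitWord D n s = digitWord D n t) : dist s t ≤ ((D : ℝ) ^ n)⁻¹ := by
  refine (dist_le_abs_rep_sub s t).trans ?_
  have hs : s ∈ digitWord D n ⁻¹' {digitWord D n t} := h
  have ht : t ∈ digitWord D n ⁻¹' {digitWord D n t} := rfl
  rw [digitWord_preimage, Set.mem_preimage, Set.mem_Ico, add_div, one_div] at hs ht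
  rw [abs_le]
  constructor <;> linarith

end Digits

/-! ### Husimi masses of D-adic squares -/

section Husimi

variable {D : ℕ}

/-- The word of length `k` whose first `l` letters are those of `e` and whose last `k - l` letters
are those of `e'`, in reverse order. -/
def joinWord {k l : ℕ} (hl : l ≤ k) :
    (Fin l → Fin D) × (Fin (k - l) → Fin D) ≃ (Fin k → Fin D) where
  toFun e i := if h : (i : ℕ) < l then e.1 ⟨i, h⟩ else e.2 ⟨k - 1 - i, by omega⟩
  invFun y := (fun i => y ⟨i, by omega⟩, fun i => y ⟨k - 1 - i, by omega⟩)
  left_inv e := by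
    ext i
    · simp
    · have h : ¬ k - 1 - (i : ℕ) < l := by omega
      have h' : k - 1 - (k - 1 - (i : ℕ)) = i := by omega
      simp only [h, dite_false, h', Fin.eta]
  right_inv y := by
    funext i
    dsimp only
    split_ifs
    · rfl
    · congr 1
      ext
      simp only
      omega

theorem coherentState_eq {k l : ℕ} (hl : l ≤ k) (e : (Fin l → Fin D) × (Fin (k - l) → Fin D)) :
    coherentState D k l e.1 e.2 = siteState D k l (joinWord hl e) := by
  ext α
  simp only [coherentState, siteState, piKronecker, Matrix.of_apply, siteBasis, joinWord,
    Equiv.coe_fn_mk]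
  refine Finset.prod_congr rfl fun i _ => ?_
  by_cases h : (i : ℕ) < l
  · simp only [dif_pos h, if_pos h]
    exact (Matrix.one_apply ..).symm
  · simp only [dif_neg h, if_neg h]

variable [NeZero D]

/-- The word with prefix `w` and reversed suffix `w'`. -/
def edgeWord (k : ℕ) {n : ℕ} (w w' : Fin n → Fin D) (i : Fin k) : Fin D :=
  if h : (i : ℕ) < n then w ⟨i, h⟩ else if h' : k - 1 - i < n then w' ⟨k - 1 - i, h'⟩ else 0

/-- Momentum digits are stored backwards from the last site, so leading digits of q and p sit at the
two ends of the word. -/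
theorem joinWord_edges_iff {k l n : ℕ} (hl : l ≤ k) (h1 : n ≤ l) (h2 : n ≤ k - l)
    (w w' : Fin n → Fin D) (e : (Fin l → Fin D) × (Fin (k - l) → Fin D)) :
    (∀ i ∈ edges k n, joinWord hl e i = edgeWord k w w' i) ↔
      e.1 ∘ Fin.castLE h1 = w ∧ e.2 ∘ Fin.castLE h2 = w' := by
  simp only [edges, Finset.mem_filter, Finset.mem_univ, true_and, joinWord, Equiv.coe_fn_mk,
    edgeWord, funext_iff, Function.comp_apply]
  constructor
  · refine fun h => ⟨fun i => ?_, fun i => ?_⟩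
    · have := h ⟨i, by omega⟩ (Or.inl i.2)
      rw [dif_pos (by simp only; omega), dif_pos i.2] at this
      exact this
    · have := h ⟨k - 1 - i, by omega⟩ (Or.inr (by simp only; omega))
      have hi : k - 1 - (k - 1 - (i : ℕ)) = i := by omega
      rw [dif_neg (by simp only; omega), dif_neg (by simp only; omega),
        dif_pos (by simp only; omega)] at this
      simp only [hi] at this
      exact this
  · rintro ⟨h, h'⟩ i hi
    rcases hi with hi | hi
    · rw [dif_pos (by omega), dif_pos hi]
      exact h ⟨i, hi⟩
    · rw [dif_neg (by omega), dif_neg (by omega), dif_pos (by omega)]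
      exact h' ⟨k - 1 - i, by omega⟩

/-- The digit words of both coordinates of a point of the torus. -/
def digitPair (D : ℕ) [NeZero D] (m n : ℕ) (x : Torus) : (Fin m → Fin D) × (Fin n → Fin D) :=
  (digitWord D m x.1, digitWord D n x.2)

theorem measurable_digitPair (m n : ℕ) : Measurable (digitPair D m n) :=
  ((measurable_digitWord m).comp measurable_fst).prodMk
    ((measurable_digitWord n).comp measurable_snd)

theorem volume_digitPair_preimage (m n : ℕ) (e : (Fin m → Fin D) × (Fin n → Fin D)) :
    volume (digitPair D m n ⁻¹' {e}) = ENNReal.ofReal (((D : ℝ) ^ (m + n))⁻¹) := by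
  have : digitPair D m n ⁻¹' {e} = (digitWord D m ⁻¹' {e.1}) ×ˢ (digitWord D n ⁻¹' {e.2}) := by
    ext x
    simp [digitPair, Prod.ext_iff]
  rw [this, Measure.volume_eq_prod, Measure.prod_prod, volume_digitWord_preimage,
    volume_digitWord_preimage, ← ENNReal.ofReal_mul (by positivity), pow_add, mul_inv]

theorem lebesgueMeasure_real_digitPair (n : ℕ) (e : (Fin n → Fin D) × (Fin n → Fin D)) :
    (lebesgueMeasure : Measure Torus).real (digitPair D n n ⁻¹' {e}) =
      ((D : ℝ) ^ (2 * n))⁻¹ := by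
  rw [two_mul]
  change (volume (digitPair D n n ⁻¹' {e})).toReal = _
  rw [volume_digitPair_preimage, ENNReal.toReal_ofReal (by positivity)]

/-- The square is a union of quantum rectangles, on each of which the factor Dᵏ of the density
cancels the area D⁻ᵏ. -/
theorem husimiMeasure_real_digitPair {k l n : ℕ} (hl : l ≤ k) (h1 : n ≤ l) (h2 : n ≤ k - l)
    (ψ : QSpace D k) (e : (Fin n → Fin D) × (Fin n → Fin D)) :
    (husimiMeasure D k l ψ : Measure Torus).real (digitPair D n n ⁻¹' {e}) =
      edgeMass n (edgeWord k e.1 e.2) ψ := by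
  classical
  obtain ⟨w, w'⟩ := e
  have hD : (0 : ℝ) < (D : ℝ) ^ k := pow_pos (Nat.cast_pos.2 (NeZero.pos D)) k
  set S : Finset ((Fin l → Fin D) × (Fin (k - l) → Fin D)) :=
    {e | ∀ i ∈ edges k n, joinWord hl e i = edgeWord k w w' i} with hS
  have hpre : digitPair D n n ⁻¹' {(w, w')} = digitPair D l (k - l) ⁻¹' (S : Set _) := by
    ext x
    simp only [Set.mem_preimage, Set.mem_singleton_iff, hS, Finset.coe_filter, Finset.mem_univ,
      true_and, Set.mem_ofPred_eq, joinWord_edges_iff hl h1 h2, digitPair, Prod.mk.injEq]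
    rfl
  have hhus : ∀ x, ENNReal.ofReal (husimi D k l ψ x) = (fun e => ENNReal.ofReal
      ((D : ℝ) ^ k * weight D k l ψ (joinWord hl e))) (digitPair D l (k - l) x) := by
    intro x
    simp only [husimi, weight, ← coherentState_eq, digitPair]
  have hmeas : MeasurableSet (S : Set ((Fin l → Fin D) × (Fin (k - l) → Fin D))) :=
    S.measurableSet
  have hmass : (husimiMeasure D k l ψ : Measure Torus) (digitPair D n n ⁻¹' {(w, w')}) =
      ENNReal.ofReal (edgeMass n (edgeWord k w w') ψ) := by
    change (volume.withDensity fun x => ENNReal.ofReal (husimi D k l ψ x)) _ = _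
    rw [hpre, withDensity_apply _ (measurable_digitPair _ _ hmeas)]
    simp only [hhus]
    rw [← setLIntegral_map (f := fun e => ENNReal.ofReal
        ((D : ℝ) ^ k * weight D k l ψ (joinWord hl e))) hmeas (measurable_of_countable _)
        (measurable_digitPair _ _), lintegral_finset]
    have hterm : ∀ e ∈ S, ENNReal.ofReal ((D : ℝ) ^ k * weight D k l ψ (joinWord hl e)) *
        (volume.map (digitPair D l (k - l))) {e} =
          ENNReal.ofReal (weight D k l ψ (joinWord hl e)) := by
      intro e _
      rw [Measure.map_apply (measurable_digitPair _ _) (measurableSet_singleton e),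
        volume_digitPair_preimage, ← ENNReal.ofReal_mul (mul_nonneg hD.le (weight_nonneg _ _ _ _ _)),
        Nat.add_sub_cancel' hl, mul_comm, ← mul_assoc, inv_mul_cancel₀ hD.ne', one_mul]
    rw [Finset.sum_congr rfl hterm,
      ← ENNReal.ofReal_sum_of_nonneg fun _ _ => weight_nonneg _ _ _ _ _,
      ← sum_weight_edges h1 (by omega : l + n ≤ k), hS, Finset.sum_filter, Finset.sum_filter]
    congr 1
    exact Fintype.sum_equiv (joinWord hl) _ _ fun e => rfl
  rw [Measure.real, hmass, ENNReal.toReal_ofReal (edgeMass_nonneg _ _ _)]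

theorem exists_digitPair_oscillation_le (hD : 2 ≤ D) (f : BoundedContinuousFunction Torus ℝ)
    {ε : ℝ} (hε : 0 < ε) :
    ∃ n, ∀ x y, digitPair D n n x = digitPair D n n y → |f x - f y| ≤ ε := by
  have huc : UniformContinuous f := CompactSpace.uniformContinuous_of_continuous f.continuous
  obtain ⟨η, hη, h⟩ := Metric.uniformContinuous_iff.1 huc ε hε
  have hD1 : ((D : ℝ))⁻¹ < 1 := inv_lt_one_of_one_lt₀ (by exact_mod_cast hD)
  obtain ⟨n, hn⟩ := exists_pow_lt_of_lt_one hη hD1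
  rw [inv_pow] at hn
  refine ⟨n, fun x y hxy => ?_⟩
  rw [digitPair, digitPair, Prod.mk.injEq] at hxy
  refine (h ?_).le
  exact max_lt ((dist_le_of_digitWord_eq hxy.1).trans_lt hn)
    ((dist_le_of_digitWord_eq hxy.2).trans_lt hn)

end Husimi

/-! ### Decay of the quantum variance and conclusion -/

section Ergodicity

variable {D : ℕ} [NeZero D]

theorem tendsto_average_sq_edgeMass_sub
    (ψ : ∀ k : ℕ, OrthonormalBasis (Fin (D ^ k)) ℂ (QSpace D k))
    (hψ : ∀ k : ℕ, 1 ≤ k → ∀ j, ∃ c : ℂ, Module.End.HasEigenvector (bakerOp D k) c (ψ k j))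
    (n : ℕ) (u : ∀ k, Fin k → Fin D) :
    Tendsto (fun k => (∑ j, (edgeMass n (u k) (ψ k j) - ((D : ℝ) ^ (2 * n))⁻¹) ^ 2) /
      ((D ^ k : ℕ) : ℝ)) atTop (𝓝 0) := by
  -- M = k / (2n + 1) windows: dividing by 2n + 1 instead of 2n also covers n = 0.
  have hM : Tendsto (fun k => k / (2 * n + 1)) atTop atTop :=
    Nat.tendsto_div_const_atTop (by omega)
  have hlim : Tendsto (fun k => (((k / (2 * n + 1) : ℕ) : ℝ))⁻¹) atTop (𝓝 0) :=
    tendsto_inv_atTop_zero.comp (tendsto_natCast_atTop_atTop.comp hM)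
  refine tendsto_of_tendsto_of_tendsto_of_le_of_le' tendsto_const_nhds hlim
    (Eventually.of_forall fun k => div_nonneg (Finset.sum_nonneg fun j _ => sq_nonneg _)
      (Nat.cast_nonneg _)) ?_
  filter_upwards [hM.eventually_ge_atTop 1, eventually_ge_atTop 1] with k hk hk1
  have hDk : (0 : ℝ) < (D : ℝ) ^ k := pow_pos (Nat.cast_pos.2 (NeZero.pos D)) k
  have hle : 2 * n * (k / (2 * n + 1)) ≤ k :=
    (Nat.mul_le_mul_right _ (Nat.le_succ _)).trans (Nat.mul_div_le k _)
  rw [Nat.cast_pow, div_le_iff₀ hDk, inv_mul_eq_div]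
  exact sum_sq_edgeMass_sub_le (ψ k) (hψ k hk1) hk hle (u k)

end Ergodicity

end WalshBaker

end

theorem mainTheorem5 (D : ℕ) [NeZero D] (hD : 2 ≤ D)
    (ψ : ∀ k : ℕ, OrthonormalBasis (Fin (D ^ k)) ℂ (WalshBaker.QSpace D k))
    (hψ : ∀ k : ℕ, 1 ≤ k → ∀ j : Fin (D ^ k),
      ∃ c : ℂ, Module.End.HasEigenvector (WalshBaker.bakerOp D k) c (ψ k j)) :
    ∃ J : ∀ k : ℕ, Finset (Fin (D ^ k)),
      (∀ k : ℕ, 1 ≤ k → (J k).Nonempty) ∧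
      Tendsto (fun k : ℕ => ((J k).card : ℝ) / (D : ℝ) ^ k) atTop (𝓝 1) ∧
      ∀ l : ℕ → ℕ, (∀ k : ℕ, 1 ≤ k → l k ≤ k) →
        Tendsto l atTop atTop → Tendsto (fun k : ℕ => k - l k) atTop atTop →
        ∀ j : ∀ k : ℕ, Fin (D ^ k), (∀ k : ℕ, 1 ≤ k → j k ∈ J k) →
          Tendsto (fun k : ℕ => WalshBaker.husimiMeasure D k (l k) (ψ k (j k))) atTop
            (𝓝 WalshBaker.lebesgueMeasure) := by
  -- All D-adic squares of all scales: a countable family, chosen before l and j.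
  let I : Type := Σ n : ℕ, (Fin n → Fin D) × (Fin n → Fin D)
  let a : ℕ → ℝ := fun n => ((D : ℝ) ^ (2 * n))⁻¹
  let m : I → ∀ k, Fin (D ^ k) → ℝ := fun i k j =>
    WalshBaker.edgeMass i.1 (WalshBaker.edgeWord k i.2.1 i.2.2) (ψ k j)
  have hm0 : ∀ i k j, 0 ≤ m i k j := fun i k j => WalshBaker.edgeMass_nonneg _ _ _
  have hm1 : ∀ i k j, m i k j ≤ 1 := fun i k j =>
    (WalshBaker.edgeMass_le _ _ _).trans_eq (by rw [(ψ k).orthonormal.1 j, one_pow])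
  have ha0 : ∀ n, 0 ≤ a n := fun n => by positivity
  have ha1 : ∀ n, a n ≤ 1 := fun n =>
    inv_le_one_of_one_le₀ (one_le_pow₀ (by exact_mod_cast NeZero.one_le))
  obtain ⟨J, hJne, hJcard, hJ⟩ := WalshBaker.exists_density_one_subsets
    (N := fun k => D ^ k) (d := fun i k j => (m i k j - a i.1) ^ 2)
    (fun i k j => sq_nonneg _)
    (fun i k j => by
      rw [sq_le_one_iff_abs_le_one, abs_le]
      constructor <;> linarith [hm0 i k j, hm1 i k j, ha0 i.1, ha1 i.1])
    (fun i => WalshBaker.tendsto_average_sq_edgeMass_sub ψ hψ i.1 _)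
  refine ⟨J, fun k _ => hJne k, by simpa using hJcard, fun l hl hl1 hl2 j hj => ?_⟩
  refine WalshBaker.tendsto_finiteMeasure_of_partitions
    (fun n => WalshBaker.measurable_digitPair (D := D) n n)
    (fun f ε hε => WalshBaker.exists_digitPair_oscillation_le hD f hε) fun n e => ?_
  have hsq := hJ ⟨n, e⟩ j ((eventually_ge_atTop 1).mono hj)
  have hlim : Tendsto (fun k => m ⟨n, e⟩ k (j k)) atTop (𝓝 (a n)) := by
    rw [tendsto_iff_dist_tendsto_zero]
    simpa [Real.sqrt_sq_eq_abs, Real.dist_eq] using hsq.sqrt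
  rw [WalshBaker.lebesgueMeasure_real_digitPair]
  -- Husimi and edge masses need to agree only once l k and k - l k both reach n.
  refine hlim.congr' ?_
  filter_upwards [hl1.eventually_ge_atTop n, hl2.eventually_ge_atTop n, eventually_ge_atTop 1]
    with k h1 h2 hk
  exact (WalshBaker.husimiMeasure_real_digitPair (hl k hk) h1 h2 _ e).symm
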